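/- Throughout, a \emph{normal domain} is a Noetherian integral domain that is integrally closed in its field of fractions. For a normal domain $A$ and an $A$-module $M$ put $M^{*_A}=\operatorname{Hom}_A(M,A)$ and $M^{**_A}=(M^{*_A})^{*_A}$; $M$ is \emph{reflexive} if the natural biduality map $M\to M^{**_A}$ is an isomorphism. The divisor class group $\operatorname{Cl}(A)$ is the abelian group of isomorphism classes $[\mathfrak a]$ of finitely generated reflexive $A$-modules $\mathfrak a$ of rank one, with product $[\mathfrak a]\cdot[\mathfrak b]=[(\mathfrak a\otimes_A\mathfrak b)^{**_A}]$, identity $[A]$ and inverse $[\mathfrak a]^{-1}=[\mathfrak a^{*_A}]$. Let $\operatorname{UFD}(A)$ be the set of $\mathfrak p\in\operatorname{Spec}(A)$ such that $A_{\mathfrak p}$ is a unique factorization domain. We say that a ring homomorphism $\varphi\colon A\to B$ of normal domains satisfies condition $(\dagger)$ if $\varphi^{-1}(P)\in\operatorname{UFD}(A)$ for every prime ideal $P\in\operatorname{Spec}(B)$ of height at most one. In that case there is a well-defined group homomorphism $\operatorname{Cl}(\varphi)\colon\operatorname{Cl}(A)\to\operatorname{Cl}(B)$ given by $[\mathfrak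 a]\mapsto[(\mathfrak a\otimes_AB)^{**_B}]$. \textbf{Theorem.} Let $\varphi\colon A\to B$ and $\psi\colon B\to C$ be ring homomorphisms of normal domains such that each of $\varphi$, $\psi$ and $\psi\circ\varphi$ satisfies $(\dagger)$. Then the induced group homomorphisms $\operatorname{Cl}(\varphi)$, $\operatorname{Cl}(\psi)$ and $\operatorname{Cl}(\psi\circ\varphi)$ exist and $$\operatorname{Cl}(\psi\circ\varphi)=\operatorname{Cl}(\psi)\circ\operatorname{Cl}(\varphi)\colon\operatorname{Cl}(A)\to\operatorname{Cl}(C).$$ -/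

import Mathlib

open Module TensorProduct
open scoped nonZeroDivisors

universe u

/-- A finitely generated reflexive `A`-module of rank one: the biduality map `M → M**` is bijective
and `K ⊗ M` is one-dimensional over the field of fractions `K` of `A`. -/
class IsRankOneReflexive (A : Type u) [CommRing A] [IsDomain A]
    (M : Type u) [AddCommGroup M] [Module A M] : Prop where
  finite : Module.Finite A M
  reflexive : Module.IsReflexive A M
  rank_one : Module.finrank (FractionRing A) (FractionRing A ⊗[A] M) = 1

/-- The double dual `M** = Hom_A(Hom_A(M, A), A)`. -/
abbrev DoubleDual (A : Type u) [CommRing A] (M : Type u) [AddCommGroup M] [Module A M] : Type u :=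
  Dual A (Dual A M)

namespace DivisorClass

section Rank

variable {A : Type u} [CommRing A] [IsDomain A]
  {M N : Type u} [AddCommGroup M] [Module A M] [AddCommGroup N] [Module A N]

/-- Auxiliary elementary description of rank one: an element `e` and a functional `g` with
`g e ≠ 0` such that `(g e) m = (g m) e` modulo torsion for all `m`. -/
def GenericGenerator (A : Type u) [CommRing A]
    (M : Type u) [AddCommGroup M] [Module A M] : Prop :=
  ∃ (e : M) (g : Dual A M), g e ≠ 0 ∧ ∀ m : M, ∃ t : A, t ≠ 0 ∧ t • (g e • m - g m • e) = 0

theorem GenericGenerator.finrank_eq_one (h : GenericGenerator A M) :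
    Module.finrank (FractionRing A) (FractionRing A ⊗[A] M) = 1 := by
  obtain ⟨e, g, hge, hm⟩ := h
  have hne : (1 : FractionRing A) ⊗ₜ[A] e ≠ 0 := by
    intro h0
    have h1 := congrArg (TensorProduct.rid A (FractionRing A) ∘ (g.lTensor (FractionRing A))) h0
    simp only [Function.comp_apply, LinearMap.lTensor_tmul, TensorProduct.rid_tmul, map_zero] at h1
    rw [Algebra.smul_def, mul_one] at h1
    exact hge ((FaithfulSMul.algebraMap_eq_zero_iff A (FractionRing A)).1 h1)
  rw [finrank_eq_one_iff_of_nonzero' _ hne]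
  have hgK : algebraMap A (FractionRing A) (g e) ≠ 0 := fun h0 =>
    hge ((FaithfulSMul.algebraMap_eq_zero_iff A (FractionRing A)).1 h0)
  intro w
  induction w using TensorProduct.induction_on with
  | zero => exact ⟨0, zero_smul _ _⟩
  | add x y hx hy =>
    obtain ⟨a, rfl⟩ := hx
    obtain ⟨b, rfl⟩ := hy
    exact ⟨a + b, add_smul _ _ _⟩
  | tmul k m =>
    obtain ⟨t, ht, h0⟩ := hm m
    have htK : algebraMap A (FractionRing A) t ≠ 0 := fun h0 =>
      ht ((FaithfulSMul.algebraMap_eq_zero_iff A (FractionRing A)).1 h0)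
    refine ⟨k * algebraMap A (FractionRing A) (g m) / algebraMap A (FractionRing A) (g e), ?_⟩
    have h1 : t • (g e • m) = t • (g m • e) := by
      rw [smul_sub, sub_eq_zero] at h0
      exact h0
    rw [TensorProduct.smul_tmul', smul_eq_mul, mul_one]
    calc (k * algebraMap A (FractionRing A) (g m) / algebraMap A (FractionRing A) (g e)) ⊗ₜ[A] e
        = ((t * g m) • (k / (algebraMap A (FractionRing A) t * algebraMap A (FractionRing A) (g e))))
            ⊗ₜ[A] e := by
          congr 1
          rw [Algebra.smul_def, map_mul]
          field_simp
      _ = (k / (algebraMap A (FractionRing A) t * algebraMap A (FractionRing A) (g e)))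
            ⊗ₜ[A] (t • (g e • m)) := by
          rw [TensorProduct.smul_tmul, h1, mul_smul]
      _ = k ⊗ₜ[A] m := by
          rw [← mul_smul, ← TensorProduct.smul_tmul]
          congr 1
          rw [Algebra.smul_def, map_mul]
          field_simp

theorem GenericGenerator.of_finrank [Module.Finite A M]
    (h : Module.finrank (FractionRing A) (FractionRing A ⊗[A] M) = 1) : GenericGenerator A M := by
  let K := FractionRing A
  let ℓ : K ⊗[A] M ≃ₗ[K] K := LinearEquiv.ofFinrankEq _ _ (by rw [h, finrank_self])
  let l : M →ₗ[A] K := (ℓ.toLinearMap.restrictScalars A) ∘ₗ TensorProduct.mk A K M 1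
  obtain ⟨s, hs⟩ := (Module.Finite.fg_top : (⊤ : Submodule A M).FG)
  classical
  obtain ⟨d, hd⟩ := IsLocalization.exist_integer_multiples_of_finset A⁰ (s.image l)
  have hint : ∀ m : M, (d : A) • l m ∈ LinearMap.range (Algebra.linearMap A K) := by
    intro m
    have hmem : m ∈ Submodule.span A (s : Set M) := hs ▸ Submodule.mem_top
    induction hmem using Submodule.span_induction with
    | mem x hx =>
      obtain ⟨a, ha⟩ := hd (l x) (Finset.mem_image_of_mem l hx)
      exact ⟨a, ha⟩
    | zero => simp
    | add x y _ _ hx hy => rw [map_add, smul_add]; exact Submodule.add_mem _ hx hy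
    | smul a x _ hx => rw [map_smul, smul_comm]; exact Submodule.smul_mem _ a hx
  have hinj : Function.Injective (Algebra.linearMap A K) := FaithfulSMul.algebraMap_injective A K
  let E := LinearEquiv.ofInjective (Algebra.linearMap A K) hinj
  let g : M →ₗ[A] A := E.symm.toLinearMap ∘ₗ (((d : A) • l).codRestrict _ hint)
  have hg : ∀ m, algebraMap A K (g m) = (d : A) • l m := fun m =>
    congrArg Subtype.val (E.apply_symm_apply (((d : A) • l).codRestrict _ hint m))
  have hdK : algebraMap A K d ≠ 0 := fun h0 =>
    nonZeroDivisors.coe_ne_zero d ((FaithfulSMul.algebraMap_eq_zero_iff A K).1 h0)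
  have hex : ∃ e, g e ≠ 0 := by
    by_contra hcon
    push Not at hcon
    have hl : ∀ m, l m = 0 := fun m => by
      have h1 := hg m
      rw [hcon m, map_zero, Algebra.smul_def] at h1
      exact (mul_eq_zero.1 h1.symm).resolve_left hdK
    have hz : ∀ w : K ⊗[A] M, ℓ w = 0 := by
      intro w
      induction w using TensorProduct.induction_on with
      | zero => exact map_zero _
      | add x y hx hy => rw [map_add, hx, hy, add_zero]
      | tmul k m =>
        have : k ⊗ₜ[A] m = k • ((1 : K) ⊗ₜ[A] m) := by
          rw [TensorProduct.smul_tmul', smul_eq_mul, mul_one]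
        rw [this, map_smul]
        have h2 : ℓ ((1 : K) ⊗ₜ[A] m) = 0 := hl m
        rw [h2, smul_zero]
    exact one_ne_zero ((ℓ.apply_symm_apply (1 : K)).symm.trans (hz _))
  obtain ⟨e, he⟩ := hex
  refine ⟨e, g, he, fun m => ?_⟩
  have h0 : TensorProduct.mk A K M 1 (g e • m - g m • e) = 0 := by
    apply ℓ.injective
    have h1 : l (g e • m - g m • e) = 0 := by
      rw [map_sub, map_smul, map_smul, Algebra.smul_def, Algebra.smul_def, hg, hg,
        Algebra.smul_def, Algebra.smul_def]
      ring
    exact h1.trans (map_zero ℓ).symm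
  obtain ⟨t, ht⟩ := (IsLocalizedModule.eq_zero_iff A⁰ (TensorProduct.mk A K M 1)).1 h0
  exact ⟨t, nonZeroDivisors.coe_ne_zero t, ht⟩

/-- For a module with a generic generator, `(g e) h(m) = h(e) g(m)` for every functional `h`. -/
theorem GenericGenerator.exists_functional (h : GenericGenerator A M) :
    ∃ (e : M) (g : Dual A M), g e ≠ 0 ∧ ∀ k : Dual A M, g e • k = k e • g := by
  obtain ⟨e, g, hge, hm⟩ := h
  refine ⟨e, g, hge, fun k => LinearMap.ext fun m => ?_⟩
  obtain ⟨t, ht, h0⟩ := hm m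
  have h1 := congrArg k h0
  rw [map_smul, map_sub, map_smul, map_smul, map_zero, smul_eq_mul] at h1
  have h2 := (mul_eq_zero.1 h1).resolve_left ht
  simp only [smul_eq_mul, LinearMap.smul_apply] at h2 ⊢
  linear_combination h2

theorem GenericGenerator.dual (h : GenericGenerator A M) : GenericGenerator A (Dual A M) := by
  obtain ⟨e, g, hge, hk⟩ := h.exists_functional
  refine ⟨g, Dual.eval A M e, hge, fun k => ⟨1, one_ne_zero, ?_⟩⟩
  simp only [Dual.eval_apply, hk k, sub_self, smul_zero]

theorem GenericGenerator.tensor (hM : GenericGenerator A M) (hN : GenericGenerator A N) :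
    GenericGenerator A (M ⊗[A] N) := by
  obtain ⟨e, g, hge, hm⟩ := hM
  obtain ⟨e', g', hge', hn⟩ := hN
  let G : Dual A (M ⊗[A] N) := TensorProduct.dualDistrib A M N (g ⊗ₜ g')
  refine ⟨e ⊗ₜ e', G, ?_, fun w => ?_⟩
  · simpa [G] using ⟨hge, hge'⟩
  induction w using TensorProduct.induction_on with
  | zero => exact ⟨1, one_ne_zero, by simp⟩
  | add x y hx hy =>
    obtain ⟨s, hs, hs0⟩ := hx
    obtain ⟨t, ht, ht0⟩ := hy
    refine ⟨s * t, mul_ne_zero hs ht, ?_⟩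
    have : G (e ⊗ₜ e') • (x + y) - G (x + y) • (e ⊗ₜ[A] e') =
        (G (e ⊗ₜ e') • x - G x • (e ⊗ₜ[A] e')) + (G (e ⊗ₜ e') • y - G y • (e ⊗ₜ[A] e')) := by
      rw [map_add, smul_add, add_smul]; abel
    rw [this, smul_add, mul_comm s t, mul_smul, hs0, mul_comm t s, mul_smul, ht0]
    simp
  | tmul m n =>
    obtain ⟨s, hs, hs0⟩ := hm m
    obtain ⟨t, ht, ht0⟩ := hn n
    refine ⟨s * t, mul_ne_zero hs ht, ?_⟩
    rw [smul_sub, sub_eq_zero] at hs0 ht0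
    have h1 : (s • g e • m) ⊗ₜ[A] (t • g' e' • n) = (s • g m • e) ⊗ₜ[A] (t • g' n • e') := by
      rw [hs0, ht0]
    simp only [TensorProduct.smul_tmul_smul] at h1
    simp only [G, TensorProduct.dualDistrib_apply]
    rw [smul_sub, sub_eq_zero]
    exact h1

theorem GenericGenerator.self : GenericGenerator A A :=
  ⟨1, LinearMap.id, one_ne_zero, fun m => ⟨1, one_ne_zero, by simp⟩⟩

/-- The dual of a module of rank one is reflexive. -/
theorem GenericGenerator.isReflexive_dual (h : GenericGenerator A M) :
    Module.IsReflexive A (Dual A M) := by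
  obtain ⟨e, g, hge, hk⟩ := h.exists_functional
  have hx : ∀ x : DoubleDual A M, g e • x = x g • Dual.eval A M e := by
    intro x
    refine LinearMap.ext fun k => ?_
    have h1 := congrArg x (hk k)
    rw [map_smul, map_smul] at h1
    simp only [LinearMap.smul_apply, Dual.eval_apply, smul_eq_mul] at h1 ⊢
    linear_combination h1
  refine ⟨⟨fun k k' hkk => LinearMap.ext fun m => ?_, fun F => ?_⟩⟩
  · exact congrArg (fun G : Dual A (DoubleDual A M) => G (Dual.eval A M m)) hkk
  · refine ⟨F ∘ₗ Dual.eval A M, LinearMap.ext fun x => ?_⟩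
    apply mul_left_cancel₀ hge
    have h1 := congrArg F (hx x)
    rw [map_smul, map_smul] at h1
    have h2 := congrArg (fun y : DoubleDual A M => y (F ∘ₗ Dual.eval A M)) (hx x)
    simp only [LinearMap.smul_apply, Dual.eval_apply, smul_eq_mul, LinearMap.comp_apply] at h1 h2 ⊢
    rw [h1, h2]

end Rank

section Instances

variable {A : Type u} [CommRing A] [IsDomain A]
  {M N P : Type u} [AddCommGroup M] [Module A M] [AddCommGroup N] [Module A N]
  [AddCommGroup P] [Module A P]

theorem genericGenerator_of_isRankOneReflexive (h : IsRankOneReflexive A M) :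
    GenericGenerator A M :=
  haveI := h.finite
  .of_finrank h.rank_one

theorem isRankOneReflexive_dual [IsNoetherianRing A] [Module.Finite A M]
    (h : GenericGenerator A M) : IsRankOneReflexive A (Dual A M) where
  finite := inferInstance
  reflexive := h.isReflexive_dual
  rank_one := h.dual.finrank_eq_one

instance isRankOneReflexive_self : IsRankOneReflexive A A where
  finite := inferInstance
  reflexive := inferInstance
  rank_one := GenericGenerator.self.finrank_eq_one

instance isRankOneReflexive_dual_inst [IsNoetherianRing A] [h : IsRankOneReflexive A M] :
    IsRankOneReflexive A (Dual A M) :=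
  haveI := h.finite
  isRankOneReflexive_dual (genericGenerator_of_isRankOneReflexive h)

instance isRankOneReflexive_tensor [IsNoetherianRing A]
    [hM : IsRankOneReflexive A M] [hN : IsRankOneReflexive A N] :
    IsRankOneReflexive A (DoubleDual A (M ⊗[A] N)) :=
  haveI := hM.finite
  haveI := hN.finite
  isRankOneReflexive_dual ((genericGenerator_of_isRankOneReflexive hM).tensor
    (genericGenerator_of_isRankOneReflexive hN)).dual

/-- `(M** ⊗ N)* ≅ (M ⊗ N)*` for `M` of rank one. -/
theorem dual_tensor_doubleDual (hM : GenericGenerator A M) :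
    Nonempty (Dual A (DoubleDual A M ⊗[A] N) ≃ₗ[A] Dual A (M ⊗[A] N)) :=
  haveI := hM.isReflexive_dual
  ⟨(TensorProduct.comm A N (DoubleDual A M)).dualMap ≪≫ₗ
    (TensorProduct.lift.equiv (.id A) N (DoubleDual A M) A).symm ≪≫ₗ
    LinearEquiv.congrRight (Module.evalEquiv A (Dual A M)).symm ≪≫ₗ
    TensorProduct.lift.equiv (.id A) N M A ≪≫ₗ
    (TensorProduct.comm A M N).dualMap⟩

theorem doubleDual_congr (e : M ≃ₗ[A] N) : Nonempty (DoubleDual A M ≃ₗ[A] DoubleDual A N) :=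
  ⟨e.dualMap.dualMap⟩

/-- `(M** ⊗ N)** ≅ (M ⊗ N)**` for `M` of rank one. -/
theorem doubleDual_tensor_doubleDual (hM : GenericGenerator A M) :
    Nonempty (DoubleDual A (DoubleDual A M ⊗[A] N) ≃ₗ[A] DoubleDual A (M ⊗[A] N)) :=
  (dual_tensor_doubleDual hM).map fun e => e.symm.dualMap

/-- Over a normal domain every endomorphism of a dual of rank one is a homothety. -/
theorem algebraMap_end_bijective [IsNoetherianRing A] [IsIntegrallyClosed A] [Module.Finite A M]
    (hM : GenericGenerator A M) :
    Function.Bijective (Algebra.linearMap A (Module.End A (Dual A M))) := by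
  obtain ⟨e, g, hge, hk⟩ := hM.exists_functional
  constructor
  · intro a b hab
    have h1 := congrArg (fun F : Module.End A (Dual A M) => F g e) hab
    simp only [Algebra.linearMap_apply, Module.algebraMap_end_apply, LinearMap.smul_apply,
      smul_eq_mul] at h1
    exact mul_right_cancel₀ hge h1
  · intro F
    -- `F k` is determined by its value at `e`: `(g e) (F k)(e) = k(e) (F g)(e)`
    have key : ∀ k, g e * F k e = k e * F g e := by
      intro k
      have h1 := congrArg (fun k' => F k' e) (hk k)
      simpa using h1
    let K := FractionRing A
    have hgK : algebraMap A K (g e) ≠ 0 := fun h0 =>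
      hge ((FaithfulSMul.algebraMap_eq_zero_iff A K).1 h0)
    let c : K := algebraMap A K (F g e) / algebraMap A K (g e)
    have hFc : ∀ k, algebraMap A K (F k e) = c * algebraMap A K (k e) := by
      intro k
      have h1 := congrArg (algebraMap A K) (key k)
      rw [map_mul, map_mul] at h1
      rw [div_mul_eq_mul_div, eq_div_iff hgK]
      linear_combination h1
    have hpow : ∀ n : ℕ, algebraMap A K ((F ^ n) g e) = c ^ n * algebraMap A K (g e) := by
      intro n
      induction n with
      | zero => simp
      | succ n ih =>
        rw [pow_succ', Module.End.mul_apply, hFc, ih, pow_succ']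
        ring
    have hF : IsIntegral A F := Algebra.IsIntegral.isIntegral F
    obtain ⟨p, hp, hp0⟩ := hF
    have hc : IsIntegral A c := by
      refine ⟨p, hp, ?_⟩
      rw [← Polynomial.aeval_def] at hp0 ⊢
      have h1 := congrArg (fun G : Module.End A (Dual A M) => algebraMap A K (G g e)) hp0
      rw [Polynomial.aeval_eq_sum_range] at h1 ⊢
      simp only [LinearMap.coe_sum, Finset.sum_apply, LinearMap.smul_apply, map_sum, smul_eq_mul,
        map_mul, hpow, LinearMap.zero_apply, map_zero] at h1
      have h2 : (∑ i ∈ Finset.range (p.natDegree + 1), p.coeff i • c ^ i) * algebraMap A K (g e)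
          = 0 := by
        rw [Finset.sum_mul, ← h1]
        exact Finset.sum_congr rfl fun i _ => by rw [Algebra.smul_def]; ring
      exact (mul_eq_zero.1 h2).resolve_right hgK
    obtain ⟨a, ha⟩ := IsIntegrallyClosed.isIntegral_iff.1 hc
    refine ⟨a, LinearMap.ext fun k => ?_⟩
    have h1 : F k e = a * k e := by
      apply FaithfulSMul.algebraMap_injective A K
      rw [hFc, map_mul, ha]
    have h2 : g e • F k = g e • (a • k) := by
      rw [hk (F k), h1, smul_comm, hk k, mul_smul]
    rw [Algebra.linearMap_apply, Module.algebraMap_end_apply]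
    refine LinearMap.ext fun m => mul_left_cancel₀ hge ?_
    exact (congrArg (fun k' : Dual A M => k' m) h2).symm

/-- `(M* ⊗ M)** ≅ A` for `M` of rank one over a normal domain. -/
theorem doubleDual_dual_tensor [IsNoetherianRing A] [IsIntegrallyClosed A] [Module.Finite A M]
    (hM : GenericGenerator A M) :
    Nonempty (DoubleDual A (Dual A M ⊗[A] M) ≃ₗ[A] A) :=
  let e : Dual A (Dual A M ⊗[A] M) ≃ₗ[A] A :=
    (TensorProduct.lift.equiv (.id A) (Dual A M) M A).symm ≪≫ₗ
      (LinearEquiv.ofBijective _ (algebraMap_end_bijective hM)).symm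
  ⟨e.symm.dualMap ≪≫ₗ LinearMap.ringLmapEquivSelf A A A⟩

end Instances

end DivisorClass

/-- A bundled finitely generated reflexive `A`-module of rank one. -/
structure RankOneReflexive (A : Type u) [CommRing A] [IsDomain A] where
  carrier : Type u
  [addCommGroup : AddCommGroup carrier]
  [module : Module A carrier]
  [isRankOneReflexive : IsRankOneReflexive A carrier]

attribute [instance] RankOneReflexive.addCommGroup RankOneReflexive.module
  RankOneReflexive.isRankOneReflexive

/-- Two rank-one reflexive modules are equivalent if they are isomorphic. -/
instance RankOneReflexive.setoid (A : Type u) [CommRing A] [IsDomain A] :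
    Setoid (RankOneReflexive A) where
  r M N := Nonempty (M.carrier ≃ₗ[A] N.carrier)
  iseqv := ⟨fun _ => ⟨.refl _ _⟩, fun ⟨e⟩ => ⟨e.symm⟩, fun ⟨e⟩ ⟨f⟩ => ⟨e ≪≫ₗ f⟩⟩

/-- The divisor class group `Cl(A)`: isomorphism classes of finitely generated reflexive
`A`-modules of rank one. -/
def DivisorClassGroup (A : Type u) [CommRing A] [IsDomain A] : Type (u + 1) :=
  Quotient (RankOneReflexive.setoid A)

namespace DivisorClassGroup

/-- The divisor class `[M]` of a rank-one reflexive module. -/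
def cl (A : Type u) [CommRing A] [IsDomain A]
    (M : Type u) [AddCommGroup M] [Module A M] [IsRankOneReflexive A M] : DivisorClassGroup A :=
  Quotient.mk _ ⟨M⟩

section Group

variable {A : Type u} [CommRing A] [IsDomain A]

theorem cl_eq_cl {M N : Type u} [AddCommGroup M] [Module A M] [IsRankOneReflexive A M]
    [AddCommGroup N] [Module A N] [IsRankOneReflexive A N] :
    cl A M = cl A N ↔ Nonempty (M ≃ₗ[A] N) :=
  Quotient.eq

theorem ind {p : DivisorClassGroup A → Prop}
    (h : ∀ (M : Type u) [AddCommGroup M] [Module A M] [IsRankOneReflexive A M], p (cl A M))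
    (x : DivisorClassGroup A) : p x :=
  Quotient.inductionOn x fun M => h M.carrier

/-- The identity is `[A]`. -/
instance : One (DivisorClassGroup A) := ⟨cl A A⟩

/-- Multiplication is `[M] * [N] = [(M ⊗ N)**]`. -/
instance [IsNoetherianRing A] : Mul (DivisorClassGroup A) :=
  ⟨Quotient.map₂ (fun M N => ⟨DoubleDual A (M.carrier ⊗[A] N.carrier)⟩)
    fun _ _ ⟨e⟩ _ _ ⟨f⟩ => DivisorClass.doubleDual_congr (TensorProduct.congr e f)⟩

/-- The inverse is `[M]⁻¹ = [M*]`. -/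
instance [IsNoetherianRing A] : Inv (DivisorClassGroup A) :=
  ⟨Quotient.map (fun M => ⟨Dual A M.carrier⟩) fun _ _ ⟨e⟩ => ⟨e.symm.dualMap⟩⟩

theorem one_def : (1 : DivisorClassGroup A) = cl A A := rfl

theorem cl_mul_cl [IsNoetherianRing A] (M N : Type u)
    [AddCommGroup M] [Module A M] [IsRankOneReflexive A M]
    [AddCommGroup N] [Module A N] [IsRankOneReflexive A N] :
    cl A M * cl A N = cl A (DoubleDual A (M ⊗[A] N)) := rfl

theorem inv_cl [IsNoetherianRing A] (M : Type u)
    [AddCommGroup M] [Module A M] [IsRankOneReflexive A M] :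
    (cl A M)⁻¹ = cl A (Dual A M) := rfl

protected theorem mul_comm' [IsNoetherianRing A] (x y : DivisorClassGroup A) :
    x * y = y * x := by
  induction x using ind with | _ M
  induction y using ind with | _ N
  rw [cl_mul_cl, cl_mul_cl, cl_eq_cl]
  exact DivisorClass.doubleDual_congr (TensorProduct.comm A M N)

protected theorem mul_assoc' [IsNoetherianRing A] (x y z : DivisorClassGroup A) :
    x * y * z = x * (y * z) := by
  rw [DivisorClassGroup.mul_comm' x (y * z)]
  induction x using ind with | _ M
  have hM : IsRankOneReflexive A M := inferInstance
  induction y using ind with | _ N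
  have hN : IsRankOneReflexive A N := inferInstance
  induction z using ind with | _ P
  have hP : IsRankOneReflexive A P := inferInstance
  simp only [cl_mul_cl, cl_eq_cl]
  have gM := DivisorClass.genericGenerator_of_isRankOneReflexive hM
  have gN := DivisorClass.genericGenerator_of_isRankOneReflexive hN
  have gP := DivisorClass.genericGenerator_of_isRankOneReflexive hP
  obtain ⟨e⟩ := DivisorClass.doubleDual_tensor_doubleDual (N := P) (gM.tensor gN)
  obtain ⟨f⟩ := DivisorClass.doubleDual_congr
    (TensorProduct.assoc A M N P ≪≫ₗ TensorProduct.comm A M (N ⊗[A] P))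
  obtain ⟨g⟩ := DivisorClass.doubleDual_tensor_doubleDual (N := M) (gN.tensor gP)
  exact ⟨e ≪≫ₗ f ≪≫ₗ g.symm⟩

protected theorem one_mul' [IsNoetherianRing A] (x : DivisorClassGroup A) : 1 * x = x := by
  induction x using ind with | _ M
  have hM : IsRankOneReflexive A M := inferInstance
  rw [one_def, cl_mul_cl, cl_eq_cl]
  have := hM.reflexive
  obtain ⟨e⟩ := DivisorClass.doubleDual_congr (TensorProduct.lid A M)
  exact ⟨e ≪≫ₗ (Module.evalEquiv A M).symm⟩

protected theorem inv_mul_cancel' [IsNoetherianRing A] [IsIntegrallyClosed A]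
    (x : DivisorClassGroup A) : x⁻¹ * x = 1 := by
  induction x using ind with | _ M
  have hM : IsRankOneReflexive A M := inferInstance
  rw [one_def, inv_cl, cl_mul_cl, cl_eq_cl]
  have := hM.finite
  exact DivisorClass.doubleDual_dual_tensor
    (DivisorClass.genericGenerator_of_isRankOneReflexive hM)

/-- The group structure on `Cl(A)` for a (Noetherian) normal domain `A`. -/
instance [IsNoetherianRing A] [IsIntegrallyClosed A] : CommGroup (DivisorClassGroup A) where
  mul_assoc := DivisorClassGroup.mul_assoc'
  one_mul := DivisorClassGroup.one_mul'
  mul_one x := (DivisorClassGroup.mul_comm' x 1).trans (DivisorClassGroup.one_mul' x)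
  inv_mul_cancel := DivisorClassGroup.inv_mul_cancel'
  mul_comm := DivisorClassGroup.mul_comm'

end Group

end DivisorClassGroup

/-- The set `UFD(A)` of primes `𝔭` of `A` such that `A_𝔭` is a unique factorization domain. -/
def UFDLocus (A : Type u) [CommRing A] [IsDomain A] : Set (PrimeSpectrum A) :=
  {p | UniqueFactorizationMonoid (Localization.AtPrime p.asIdeal)}

/-- Every prime of `B` of height at most one contracts to a prime in `UFD(A)`. -/
def ContractsToUFDLocus {A B : Type u} [CommRing A] [IsDomain A] [CommRing B]
    (φ : A →+* B) : Prop :=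
  ∀ P : PrimeSpectrum B, P.asIdeal.height ≤ 1 → PrimeSpectrum.comap φ P ∈ UFDLocus A

/-- The group homomorphism `f : Cl(A) → Cl(B)` is the map `Cl(φ)` induced by `φ : A → B`: for every
rank-one reflexive `A`-module `M`, the `B`-module `(M ⊗_A B)**` is rank-one reflexive
and `f [M] = [(M ⊗_A B)**]`. -/
def IsInducedClassMap {A B : Type u} [CommRing A] [IsDomain A] [IsNoetherianRing A]
    [IsIntegrallyClosed A] [CommRing B] [IsDomain B] [IsNoetherianRing B] [IsIntegrallyClosed B]
    (φ : A →+* B) (f : DivisorClassGroup A →* DivisorClassGroup B) : Prop :=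
  letI : Algebra A B := φ.toAlgebra
  ∀ (M : Type u) [AddCommGroup M] [Module A M] [IsRankOneReflexive A M],
    ∃ _ : IsRankOneReflexive B (DoubleDual B (B ⊗[A] M)),
      f (DivisorClassGroup.cl A M) = DivisorClassGroup.cl B (DoubleDual B (B ⊗[A] M))

/-- The defining formula determines the induced map uniquely. -/
theorem IsInducedClassMap.unique {A B : Type u} [CommRing A] [IsDomain A] [IsNoetherianRing A]
    [IsIntegrallyClosed A] [CommRing B] [IsDomain B] [IsNoetherianRing B] [IsIntegrallyClosed B]
    {φ : A →+* B} {f g : DivisorClassGroup A →* DivisorClassGroup B}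
    (hf : IsInducedClassMap φ f) (hg : IsInducedClassMap φ g) : f = g := by
  ext x
  induction x using DivisorClassGroup.ind with | _ M
  obtain ⟨_, h₁⟩ := hf M
  obtain ⟨_, h₂⟩ := hg M
  exact h₁.trans h₂.symm

/-!
Over a unique factorization domain a reflexive module of rank one is free: a functional whose
values have greatest common divisor `1` takes the value `1`. Condition `(†)` therefore makes every
rank-one reflexive `A`-module free of rank one at the contraction of each prime of `B` of height at
most one, and this property of `M` is inherited by tensor products and by base change.

Over a normal domain divisibility, and hence whether a functional extends, can be tested at the
primes of height at most one. For such `M` the map `B ⊗ M → B ⊗ M**` thus becomes an isomorphism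
after dualizing over `B`, so the inner double duals in `(B ⊗ (M ⊗ N)**)**` and
`(C ⊗ (B ⊗ M)**)**` may be dropped, which gives multiplicativity and functoriality.
-/

namespace DivisorClass

section Functional

variable {A M : Type*} [CommRing A] [AddCommGroup M] [Module A M]

theorem exists_smul_eq_of_dvd [IsDomain A] {b : A} (hb : b ≠ 0) (g : Dual A M)
    (h : ∀ m, b ∣ g m) : ∃ g' : Dual A M, b • g' = g := by
  let E := LinearEquiv.toSpanNonzeroSingleton A A b hb
  let g₀ := g.codRestrict (A ∙ b) fun m => Ideal.mem_span_singleton.2 (h m)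
  refine ⟨E.symm.toLinearMap ∘ₗ g₀, LinearMap.ext fun m => ?_⟩
  calc b * E.symm (g₀ m) = E (E.symm (g₀ m)) := mul_comm b _
    _ = g m := by rw [E.apply_symm_apply, LinearMap.codRestrict_apply]

theorem smul_eq_smul_dual_eval {e : M} {g : Dual A M}
    (h : ∀ k : Dual A M, g e • k = k e • g) (x : Dual A (Dual A M)) :
    g e • x = x g • Dual.eval A M e := by
  ext k
  calc g e * x k = x (g e • k) := (map_smul x _ k).symm
    _ = k e * x g := by rw [h, map_smul, smul_eq_mul]
    _ = x g * k e := mul_comm _ _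

end Functional

section RankOne

variable {A : Type u} [CommRing A] [IsDomain A] {M : Type u} [AddCommGroup M] [Module A M]

theorem GenericGenerator.apply_mul_apply_comm (h : GenericGenerator A M) (k l : Dual A M)
    (x y : M) : k x * l y = k y * l x := by
  obtain ⟨e, g, hge, hg⟩ := h.exists_functional
  have value (k : Dual A M) (m : M) : g e * k m = k e * g m := LinearMap.congr_fun (hg k) m
  refine mul_left_cancel₀ (mul_ne_zero hge hge) ?_
  calc g e * g e * (k x * l y) = (g e * k x) * (g e * l y) := by ring
    _ = (g e * k y) * (g e * l x) := by rw [value, value, value, value]; ring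
    _ = g e * g e * (k y * l x) := by ring

theorem GenericGenerator.apply_smul_comm [IsReflexive A M] (h : GenericGenerator A M)
    (k : Dual A M) (m m' : M) : k m • m' = k m' • m := by
  refine (bijective_dual_eval A M).1 (LinearMap.ext fun l => ?_)
  simpa only [map_smul, LinearMap.smul_apply, Dual.eval_apply, smul_eq_mul] using
    h.apply_mul_apply_comm k l m m'

end RankOne

section PrimitiveFunctional

variable {A : Type*} [CommRing A] {M : Type*} [AddCommGroup M] [Module A M]

/-- A functional is primitive if its values have greatest common divisor `1`. This is required
also after scaling by any `a`, which is automatic over a GCD domain and lets the definition make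
sense over every commutative ring. -/
def IsPrimitive (g : Dual A M) : Prop :=
  ∀ a b : A, (∀ m, b ∣ a * g m) → b ∣ a

theorem dvd_apply_of_forall_mem_span_eq_top {s : Set M} (hs : Submodule.span A s = ⊤) {b : A}
    {g : Dual A M} (h : ∀ x ∈ s, b ∣ g x) (m : M) : b ∣ g m := by
  have : (⊤ : Submodule A M) ≤ Submodule.comap g (Ideal.span {b}) :=
    hs ▸ Submodule.span_le.2 fun x hx => Ideal.mem_span_singleton.2 (h x hx)
  exact Ideal.mem_span_singleton.1 (this (Submodule.mem_top (x := m)))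

theorem exists_smul_isPrimitive_eq [IsDomain A] [NormalizedGCDMonoid A] [Module.Finite A M]
    {g : Dual A M} (hg : g ≠ 0) :
    ∃ (d : A) (g' : Dual A M), d • g' = g ∧ IsPrimitive g' := by
  obtain ⟨s, hs⟩ := (Module.Finite.fg_top : (⊤ : Submodule A M).FG)
  have gcd_dvd (m : M) : s.gcd g ∣ g m :=
    dvd_apply_of_forall_mem_span_eq_top hs (fun x hx => Finset.gcd_dvd hx) m
  have gcd_ne_zero : s.gcd g ≠ 0 := fun h0 =>
    hg (LinearMap.ext fun m => zero_dvd_iff.1 (h0 ▸ gcd_dvd m))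
  obtain ⟨g', hg'⟩ := exists_smul_eq_of_dvd gcd_ne_zero g gcd_dvd
  refine ⟨s.gcd g, g', hg', fun a b h => ?_⟩
  have dvd_mul_apply (m : M) : b * s.gcd g ∣ a * g m := by
    calc b * s.gcd g ∣ a * g' m * s.gcd g := mul_dvd_mul_right (h m) _
      _ = a * (s.gcd g * g' m) := by ring
      _ = a * g m := congrArg (a * ·) (LinearMap.congr_fun hg' m)
  have : b * s.gcd g ∣ a * s.gcd g :=
    (Finset.dvd_gcd fun m _ => dvd_mul_apply m).trans (Finset.gcd_mul_left' s g a).dvd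
  exact (mul_dvd_mul_iff_right gcd_ne_zero).1 this

end PrimitiveFunctional

/-- The gcd of the values of a functional is attained: dividing it out leaves a primitive `g`, and
then `g e` divides every `k e`, so reflexivity provides an element with value `1`. -/
theorem GenericGenerator.exists_apply_eq_one {A : Type u} [CommRing A] [IsDomain A]
    [UniqueFactorizationMonoid A] {M : Type u} [AddCommGroup M] [Module A M] [Module.Finite A M]
    [IsReflexive A M] (h : GenericGenerator A M) : ∃ (m : M) (g : Dual A M), g m = 1 := by
  let _ : StrongNormalizationMonoid A := UniqueFactorizationMonoid.strongNormalizationMonoid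
  let _ : NormalizedGCDMonoid A := UniqueFactorizationMonoid.toNormalizedGCDMonoid A
  have ⟨e, g₀, hg₀e, _⟩ := h
  obtain ⟨d, g, rfl, hg⟩ := exists_smul_isPrimitive_eq fun h0 : g₀ = 0 => hg₀e (by simp [h0])
  have hge : g e ≠ 0 := fun h0 => hg₀e (by simp [h0])
  have apply_dvd (k : Dual A M) : g e ∣ Dual.eval A M e k :=
    hg _ _ fun m => ⟨k m, h.apply_mul_apply_comm k g e m |>.trans (mul_comm _ _)⟩
  obtain ⟨x, hx⟩ := exists_smul_eq_of_dvd hge (Dual.eval A M e) apply_dvd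
  obtain ⟨m, rfl⟩ := (bijective_dual_eval A M).2 x
  exact ⟨m, g, mul_left_cancel₀ hge ((LinearMap.congr_fun hx g).trans (mul_one _).symm)⟩

section Localization

variable {A : Type*} [CommRing A] (S : Submonoid A) (A' : Type*) [CommRing A'] [Algebra A A']
  [IsLocalization S A'] {M M' : Type*} [AddCommGroup M] [Module A M] [AddCommGroup M']
  [Module A M'] [Module A' M'] [IsScalarTower A A' M'] (f : M →ₗ[A] M') [IsLocalizedModule S f]

/-- The map from functionals on `M` to functionals on its localization. -/
noncomputable abbrev dualLocalizationMap : Dual A M →ₗ[A] Dual A' M' :=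
  IsLocalizedModule.mapExtendScalars S f (Algebra.linearMap A A') A'

theorem dualLocalizationMap_apply_apply (g : Dual A M) (m : M) :
    dualLocalizationMap S A' f g (f m) = algebraMap A A' (g m) := by
  rw [IsLocalizedModule.mapExtendScalars_apply_apply, IsLocalizedModule.map_apply,
    Algebra.linearMap_apply]

include S f in
theorem isReflexive_of_isLocalizedModule [IsNoetherianRing A] [Module.Finite A M]
    [IsReflexive A M] : IsReflexive A' M' := by
  have := finitePresentation_of_finite A M
  have := finitePresentation_of_finite A (Dual A M)
  let F := dualLocalizationMap S A' f
  let G := dualLocalizationMap S A' F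
  have eval_eq :
      (Dual.eval A' M').restrictScalars A = IsLocalizedModule.map S f G (Dual.eval A M) := by
    refine IsLocalizedModule.linearMap_ext S f G (LinearMap.ext fun m => ?_)
    refine LinearMap.restrictScalars_injective A (IsLocalizedModule.linearMap_ext S F
      (Algebra.linearMap A A') (LinearMap.ext fun g => ?_))
    simp only [LinearMap.comp_apply, LinearMap.restrictScalars_apply, IsLocalizedModule.map_apply]
    rw [Dual.eval_apply, dualLocalizationMap_apply_apply, dualLocalizationMap_apply_apply,
      Dual.eval_apply]
  have eval_bijective : Function.Bijective ((Dual.eval A' M').restrictScalars A) := by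
    rw [eval_eq]
    exact ⟨IsLocalizedModule.map_injective _ _ _ _ (bijective_dual_eval A M).1,
      IsLocalizedModule.map_surjective _ _ _ _ (bijective_dual_eval A M).2⟩
  exact ⟨eval_bijective⟩

end Localization

theorem GenericGenerator.of_isLocalizedModule {A A' : Type u} [CommRing A] [IsDomain A]
    [CommRing A'] [Algebra A A'] {S : Submonoid A} (hS : S ≤ A⁰) [IsLocalization S A']
    {M M' : Type u} [AddCommGroup M] [Module A M] [AddCommGroup M'] [Module A M'] [Module A' M']
    [IsScalarTower A A' M'] (f : M →ₗ[A] M') [IsLocalizedModule S f]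
    (h : GenericGenerator A M) : GenericGenerator A' M' := by
  obtain ⟨e, g, hge, hm⟩ := h
  have F := dualLocalizationMap_apply_apply S A' f
  have inj := IsLocalization.injective A' hS
  refine ⟨f e, dualLocalizationMap S A' f g, ?_, fun m' => ?_⟩
  · rwa [F, Ne, map_eq_zero_iff _ inj]
  obtain ⟨⟨m, s⟩, hs : (s : A) • m' = f m⟩ := IsLocalizedModule.surj S f m'
  obtain ⟨t, ht, h0⟩ := hm m
  refine ⟨algebraMap A A' (t * s), (map_ne_zero_iff _ inj).2
    (mul_ne_zero ht (nonZeroDivisors.ne_zero (hS s.2))), ?_⟩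
  have smul_eq : (s : A) • (algebraMap A A' (g e) • m' - dualLocalizationMap S A' f g m' • f e) =
      f (g e • m - g m • e) := by
    have hgm : (s : A) • dualLocalizationMap S A' f g m' = algebraMap A A' (g m) := by
      rw [← F, ← hs, LinearMap.map_smul_of_tower]
    rw [smul_sub, algebraMap_smul, smul_comm, hs, ← smul_assoc, hgm, algebraMap_smul,
      map_sub, map_smul, map_smul]
  rw [F, algebraMap_smul, mul_smul, smul_eq, ← map_smul, h0, map_zero]

section LocalGenerator

variable {A : Type u} [CommRing A] {M N : Type u} [AddCommGroup M] [Module A M]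
  [AddCommGroup N] [Module A N]

/-- The element `e` and the functional `g` exhibit `M` as free of rank one at the prime `p`, up to
`p`-torsion: `g e` is a unit at `p`, and `(g e) m = (g m) e` at `p` for every `m`. -/
structure IsLocalGenerator (p : Ideal A) [p.IsPrime] (e : M) (g : Dual A M) : Prop where
  apply_notMem : g e ∉ p
  smul_sub_smul_mem_torsion (m : M) :
    g e • m - g m • e ∈ Submodule.torsion' A M p.primeCompl

variable (M) in
/-- `M` is free of rank one at `p` up to torsion, with an explicit generator and coordinate. -/
def HasLocalGenerator (p : Ideal A) [p.IsPrime] : Prop :=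
  ∃ (e : M) (g : Dual A M), IsLocalGenerator p e g

theorem map_mem_torsion' {S : Submonoid A} (f : M →ₗ[A] N) {m : M}
    (hm : m ∈ Submodule.torsion' A M S) : f m ∈ Submodule.torsion' A N S := by
  obtain ⟨s, hs⟩ := hm
  exact ⟨s, by rw [← LinearMap.map_smul_of_tower, hs, map_zero]⟩

variable {p : Ideal A} [p.IsPrime] {e : M} {g : Dual A M}

namespace IsLocalGenerator

theorem of_apply_smul_comm (hge : g e ∉ p) (h : ∀ m m', g m • m' = g m' • m) :
    IsLocalGenerator p e g :=
  ⟨hge, fun m => by rw [h, sub_self]; exact zero_mem _⟩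

theorem genericGenerator (h : IsLocalGenerator p e g) : GenericGenerator A M := by
  have ne_zero {a : A} (ha : a ∉ p) : a ≠ 0 := fun h0 => ha (h0 ▸ p.zero_mem)
  refine ⟨e, g, ne_zero h.apply_notMem, fun m => ?_⟩
  obtain ⟨t, ht⟩ := h.smul_sub_smul_mem_torsion m
  exact ⟨t, ne_zero t.2, ht⟩

theorem apply_smul_eq [IsDomain A] (h : IsLocalGenerator p e g) (k : Dual A M) :
    g e • k = k e • g := by
  ext m
  obtain ⟨t, ht⟩ := map_mem_torsion' k (h.smul_sub_smul_mem_torsion m)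
  have : k (g e • m - g m • e) = 0 :=
    (mul_eq_zero.1 ht).resolve_left fun h0 => t.2 (h0 ▸ p.zero_mem)
  simp only [map_sub, map_smul, smul_eq_mul, sub_eq_zero] at this
  simp only [LinearMap.smul_apply, smul_eq_mul, this, mul_comm]

theorem tensor {e' : N} {g' : Dual A N} (h : IsLocalGenerator p e g)
    (h' : IsLocalGenerator p e' g') :
    IsLocalGenerator p (e ⊗ₜ[A] e') (TensorProduct.dualDistrib A M N (g ⊗ₜ g')) := by
  refine ⟨‹p.IsPrime›.mul_notMem h.apply_notMem h'.apply_notMem, fun w => ?_⟩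
  induction w using TensorProduct.induction_on with
  | zero => simp only [map_zero, smul_zero, zero_smul, sub_zero, zero_mem]
  | add x y hx hy =>
    rw [map_add, smul_add, add_smul, add_sub_add_comm]
    exact add_mem hx hy
  | tmul m n =>
    have split : (g e * g' e') • (m ⊗ₜ[A] n) - (g m * g' n) • (e ⊗ₜ[A] e') =
        (g e • m - g m • e) ⊗ₜ (g' e' • n) + (g m • e) ⊗ₜ (g' e' • n - g' n • e') := by
      simp only [TensorProduct.sub_tmul, TensorProduct.tmul_sub, TensorProduct.smul_tmul_smul]
      abel
    rw [TensorProduct.dualDistrib_apply, TensorProduct.dualDistrib_apply, split]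
    exact add_mem
      (map_mem_torsion' ((TensorProduct.mk A M N).flip _) (h.smul_sub_smul_mem_torsion m))
      (map_mem_torsion' (TensorProduct.mk A M N _) (h'.smul_sub_smul_mem_torsion n))

theorem baseChange {B : Type u} [CommRing B] [Algebra A B] {P : Ideal B} [P.IsPrime]
    (h : IsLocalGenerator (P.comap (algebraMap A B)) e g) :
    IsLocalGenerator P ((1 : B) ⊗ₜ[A] e) (Dual.baseChange B g) := by
  have value (b : B) (m : M) : Dual.baseChange B g (b ⊗ₜ m) = g m • b := rfl
  refine ⟨by rw [value, Algebra.smul_def, mul_one]; exact h.apply_notMem, fun w => ?_⟩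
  induction w using TensorProduct.induction_on with
  | zero => simp only [map_zero, smul_zero, zero_smul, sub_zero, zero_mem]
  | add x y hx hy =>
    rw [map_add, smul_add, add_smul, add_sub_add_comm]
    exact add_mem hx hy
  | tmul b m =>
    obtain ⟨t, ht⟩ := h.smul_sub_smul_mem_torsion m
    have factor : Dual.baseChange B g (1 ⊗ₜ e) • (b ⊗ₜ[A] m) -
        Dual.baseChange B g (b ⊗ₜ m) • ((1 : B) ⊗ₜ[A] e) = b ⊗ₜ[A] (g e • m - g m • e) := by
      simp only [value, smul_assoc, one_smul, TensorProduct.smul_tmul', smul_eq_mul, mul_one,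
        TensorProduct.tmul_sub, TensorProduct.tmul_smul]
    have smul_eq_zero : algebraMap A B t • (b ⊗ₜ[A] (g e • m - g m • e)) = 0 := by
      rw [algebraMap_smul, ← TensorProduct.tmul_smul, ← Submonoid.smul_def, ht,
        TensorProduct.tmul_zero]
    rw [factor]
    exact ⟨⟨algebraMap A B t, t.2⟩, smul_eq_zero⟩

end IsLocalGenerator

end LocalGenerator

/-- At a prime of the UFD locus some functional takes the value one on the localization; clearing
denominators makes its value on `M` a unit at the prime. -/
theorem hasLocalGenerator_of_mem_UFDLocus {A : Type u} [CommRing A] [IsDomain A]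
    [IsNoetherianRing A] {M : Type u} [AddCommGroup M] [Module A M] [hM : IsRankOneReflexive A M]
    {p : PrimeSpectrum A} (hp : p ∈ UFDLocus A) : HasLocalGenerator M p.asIdeal := by
  let S := p.asIdeal.primeCompl
  let R := Localization.AtPrime p.asIdeal
  let f := LocalizedModule.mkLinearMap S M
  have := hM.finite
  have := hM.reflexive
  have : UniqueFactorizationMonoid R := hp
  have : Module.Finite R (LocalizedModule S M) := .of_isLocalizedModule S f
  have : IsReflexive R (LocalizedModule S M) := isReflexive_of_isLocalizedModule S R f
  have hgen := genericGenerator_of_isRankOneReflexive hM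
  obtain ⟨m', g', hg'⟩ := (hgen.of_isLocalizedModule (A' := R)
    p.asIdeal.primeCompl_le_nonZeroDivisors f).exists_apply_eq_one
  obtain ⟨⟨e, s⟩, hs : (s : A) • m' = f e⟩ := IsLocalizedModule.surj S f m'
  have := finitePresentation_of_finite A M
  obtain ⟨⟨g, t⟩, ht : (t : A) • g' = dualLocalizationMap S R f g⟩ :=
    IsLocalizedModule.surj S (dualLocalizationMap S R f) g'
  have algebraMap_apply_eq : algebraMap A R (g e) = algebraMap A R (t * s) := by
    rw [← dualLocalizationMap_apply_apply S R f, ← ht, ← hs, LinearMap.smul_apply,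
      LinearMap.map_smul_of_tower, hg', smul_smul, Algebra.algebraMap_eq_smul_one]
  have hge : g e = t * s :=
    IsLocalization.injective R p.asIdeal.primeCompl_le_nonZeroDivisors algebraMap_apply_eq
  exact ⟨e, g, .of_apply_smul_comm (hge ▸ mul_mem t.2 s.2 : g e ∈ p.asIdeal.primeCompl)
    (hgen.apply_smul_comm g)⟩

section Normal

variable {B : Type*} [CommRing B]

section Divisibility

variable [IsDomain B] [IsIntegrallyClosed B]

/-- The fraction `c / b` multiplies a finitely generated ideal into itself, so it is integral. -/
theorem dvd_of_span_singleton_mul_le {I : Ideal B} (hI : I.FG) (hI0 : I ≠ ⊥) {b c : B}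
    (hb : b ≠ 0) (h : Ideal.span {c} * I ≤ Ideal.span {b} * I) : b ∣ c := by
  let K := FractionRing B
  have hbK : algebraMap B K b ≠ 0 := IsFractionRing.to_map_eq_zero_iff.not.2 hb
  let N : Submodule B K := Submodule.map (Algebra.linearMap B K) I
  have hN : N ≠ ⊥ := fun h0 => hI0 (Submodule.map_injective_of_injective
    (FaithfulSMul.algebraMap_injective B K) (h0.trans (Submodule.map_bot _).symm))
  have smul_mem : ∀ y ∈ N, (algebraMap B K c / algebraMap B K b) • y ∈ N := by
    rintro _ ⟨y, hy, rfl⟩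
    obtain ⟨z, hz, hbz⟩ := Ideal.span_singleton_mul_le_span_singleton_mul.1 h y hy
    refine ⟨z, hz, ?_⟩
    rw [Algebra.linearMap_apply, Algebra.linearMap_apply, smul_eq_mul, div_mul_eq_mul_div,
      eq_div_iff hbK, ← map_mul, ← map_mul, hbz, mul_comm]
  obtain ⟨x, hx⟩ := IsIntegrallyClosed.algebraMap_eq_of_integral
    (isIntegral_of_smul_mem_submodule N hN (Submodule.FG.map _ hI) _ smul_mem)
  refine ⟨x, IsFractionRing.injective B K ?_⟩
  rw [map_mul, hx, mul_div_cancel₀ _ hbK]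

variable [IsNoetherianRing B]

theorem height_le_one_of_mem_iff_dvd_mul {b c : B} (hb : b ≠ 0) {P : Ideal B} [hP : P.IsPrime]
    (h : ∀ r, r ∈ P ↔ b ∣ r * c) : P.height ≤ 1 := by
  have b_mem : b ∈ P := (h b).2 (dvd_mul_right b c)
  have not_dvd : ¬ b ∣ c := fun hbc => hP.one_notMem ((h 1).2 (by rwa [one_mul]))
  obtain ⟨y, hy, u, hu, hyu⟩ : ∃ y ∈ P, ∃ u ∉ P, b * u = c * y := by
    by_contra! hcon
    refine not_dvd (dvd_of_span_singleton_mul_le P.fg_of_isNoetherianRing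
      ((Submodule.ne_bot_iff P).2 ⟨b, b_mem, hb⟩) hb ?_)
    refine Ideal.span_singleton_mul_le_span_singleton_mul.2 fun y hy => ?_
    obtain ⟨u, hu⟩ := (h y).1 hy
    rw [mul_comm] at hu
    exact ⟨u, by_contra fun hu' => hcon y hy u hu' hu.symm, hu⟩
  -- Localized at `P`, the ideal is generated by `y`, so Krull's principal ideal theorem applies.
  refine Ideal.height_le_one_of_isPrincipal_of_mem_minimalPrimes (Ideal.span {y}) P
    ⟨⟨hP, (Ideal.span_singleton_le_iff_mem P).2 hy⟩, fun Q hQ hQP z hz => ?_⟩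
  obtain ⟨w, hw⟩ := (h z).1 hz
  have hzu : z * u = w * y := mul_left_cancel₀ hb (by linear_combination z * hyu + y * hw)
  have : z * u ∈ Q := hzu ▸ Q.mul_mem_left w ((Ideal.span_singleton_le_iff_mem Q).1 hQ.2)
  exact (hQ.1.mem_or_mem this).resolve_right fun huQ => hu (hQP huQ)

theorem dvd_of_forall_height_le_one {a b : B} (hb : b ≠ 0)
    (h : ∀ P : PrimeSpectrum B, P.asIdeal.height ≤ 1 → ∃ t ∉ P.asIdeal, b ∣ t * a) : b ∣ a := by
  by_contra hba
  have mem_colon (r c : B) : r ∈ (⊥ : Submodule B (B ⧸ Ideal.span {b})).colon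
      {Ideal.Quotient.mk (Ideal.span {b}) c} ↔ b ∣ r * c := by
    rw [Submodule.mem_colon_singleton, Submodule.mem_bot, Algebra.smul_def,
      Ideal.Quotient.algebraMap_eq, ← map_mul, Ideal.Quotient.eq_zero_iff_dvd]
  obtain ⟨P, hP, hle⟩ := exists_le_isAssociatedPrime_of_isNoetherianRing B _
    ((Ideal.Quotient.eq_zero_iff_dvd b a).not.2 hba)
  obtain ⟨hPp, x, hPx⟩ := isAssociatedPrime_iff.1 hP
  obtain ⟨c, rfl⟩ := Ideal.Quotient.mk_surjective x
  have height_le : P.height ≤ 1 :=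
    height_le_one_of_mem_iff_dvd_mul hb fun r => (SetLike.ext_iff.1 hPx r).trans (mem_colon r c)
  obtain ⟨t, ht, hta⟩ := h ⟨P, hPp⟩ height_le
  exact ht (hle ((mem_colon t a).2 hta))

end Divisibility

/-- The linear map `f` is surjective after localization at each prime of height at most one. -/
def SurjectiveInCodimOne {X Y : Type*} [AddCommGroup X] [Module B X] [AddCommGroup Y]
    [Module B Y] (f : X →ₗ[B] Y) : Prop :=
  ∀ P : PrimeSpectrum B, P.asIdeal.height ≤ 1 →
    ∀ y, ∃ t ∉ P.asIdeal, t • y ∈ LinearMap.range f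

end Normal

namespace SurjectiveInCodimOne

variable {B X : Type u} {Y : Type*} [CommRing B] [IsDomain B] [AddCommGroup X] [Module B X]
  [AddCommGroup Y] [Module B Y] {f : X →ₗ[B] Y}

theorem dualMap_injective (hf : SurjectiveInCodimOne f) : Function.Injective f.dualMap := by
  refine fun k l hkl => LinearMap.ext fun y => ?_
  obtain ⟨t, ht, x, hx⟩ := hf ⟨⊥, Ideal.isPrime_bot⟩ (by simp) y
  have ht0 : t ≠ 0 := fun h0 => ht ((Submodule.mem_bot B).2 h0)
  refine mul_left_cancel₀ ht0 ?_
  calc t * k y = k (f x) := by rw [hx, map_smul, smul_eq_mul]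
    _ = l (f x) := LinearMap.congr_fun hkl x
    _ = t * l y := by rw [hx, map_smul, smul_eq_mul]

variable [IsNoetherianRing B] [IsIntegrallyClosed B]

/-- In rank one `k` is the restriction of the fraction `(k e / G (f e)) • G`, and this fraction is
integral at every prime of height at most one. -/
theorem dualMap_surjective (hf : SurjectiveInCodimOne f) (hX : GenericGenerator B X)
    {G : Dual B Y} (hG : f.dualMap G ≠ 0) : Function.Surjective f.dualMap := by
  intro k
  obtain ⟨e, he⟩ : ∃ e, G (f e) ≠ 0 := by
    by_contra! h
    exact hG (LinearMap.ext h)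
  have cross (x : X) : k e * G (f x) = G (f e) * k x :=
    (hX.apply_mul_apply_comm k (f.dualMap G) e x).trans (mul_comm _ _)
  obtain ⟨l, hl⟩ := exists_smul_eq_of_dvd he (k e • G) fun y => by
    refine dvd_of_forall_height_le_one he fun P hP => ?_
    obtain ⟨t, ht, x, hx⟩ := hf P hP y
    refine ⟨t, ht, k x, ?_⟩
    rw [← cross, hx, map_smul, LinearMap.smul_apply, smul_eq_mul, smul_eq_mul, mul_left_comm]
  refine ⟨l, LinearMap.ext fun x => mul_left_cancel₀ he ?_⟩
  exact (LinearMap.congr_fun hl (f x)).trans (cross x)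

end SurjectiveInCodimOne

section BaseChange

variable {A B : Type u} [CommRing A] [CommRing B] [Algebra A B]
  {M N : Type u} [AddCommGroup M] [Module A M] [AddCommGroup N] [Module A N]

variable (A B M) in
/-- `M` is free of rank one, up to torsion, at the contractions to `A` of all primes of `B` of
height at most one. -/
def HasLocalGeneratorsInCodimOne : Prop :=
  ∀ P : PrimeSpectrum B, P.asIdeal.height ≤ 1 →
    HasLocalGenerator M (P.asIdeal.comap (algebraMap A B))

namespace HasLocalGeneratorsInCodimOne

theorem tensor (hM : HasLocalGeneratorsInCodimOne A B M) (hN : HasLocalGeneratorsInCodimOne A B N) :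
    HasLocalGeneratorsInCodimOne A B (M ⊗[A] N) := fun P hP =>
  let ⟨_, _, h⟩ := hM P hP
  let ⟨_, _, h'⟩ := hN P hP
  ⟨_, _, h.tensor h'⟩

theorem baseChange {C : Type u} [CommRing C] [Algebra B C] [Algebra A C] [IsScalarTower A B C]
    (h : HasLocalGeneratorsInCodimOne A C M) : HasLocalGeneratorsInCodimOne B C (B ⊗[A] M) :=
  fun P hP => by
    obtain ⟨e, g, hg⟩ := h P hP
    have := P.isPrime
    simp only [IsScalarTower.algebraMap_eq A B C, ← Ideal.comap_comap] at hg
    exact ⟨_, _, hg.baseChange⟩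

section GenericGenerator

variable [IsDomain B]

theorem genericGenerator (h : HasLocalGeneratorsInCodimOne A B M) : GenericGenerator A M :=
  let ⟨_, _, hg⟩ := h ⟨⊥, Ideal.isPrime_bot⟩ (by simp)
  hg.genericGenerator

theorem genericGenerator_baseChange (h : HasLocalGeneratorsInCodimOne A B M) :
    GenericGenerator B (B ⊗[A] M) :=
  let ⟨_, _, hg⟩ := h ⟨⊥, Ideal.isPrime_bot⟩ (by simp)
  hg.baseChange.genericGenerator

end GenericGenerator

variable [IsDomain A]

theorem surjectiveInCodimOne_baseChange_dual_eval (h : HasLocalGeneratorsInCodimOne A B M) :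
    SurjectiveInCodimOne ((Dual.eval A M).baseChange B) := by
  intro P hP w
  obtain ⟨e, g, hg⟩ := h P hP
  refine ⟨algebraMap A B (g e), hg.apply_notMem, ?_⟩
  induction w using TensorProduct.induction_on with
  | zero => rw [smul_zero]; exact zero_mem _
  | add v w hv hw => rw [smul_add]; exact add_mem hv hw
  | tmul b x =>
    refine ⟨b ⊗ₜ (x g • e), ?_⟩
    rw [LinearMap.baseChange_tmul, map_smul, ← smul_eq_smul_dual_eval hg.apply_smul_eq,
      algebraMap_smul, TensorProduct.tmul_smul]

theorem dualMap_baseChange_dual_eval_bijective [IsDomain B] [IsNoetherianRing B]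
    [IsIntegrallyClosed B] (h : HasLocalGeneratorsInCodimOne A B M) :
    Function.Bijective ((Dual.eval A M).baseChange B).dualMap := by
  have hsurj := h.surjectiveInCodimOne_baseChange_dual_eval
  obtain ⟨e, g, hg⟩ := h ⟨⊥, Ideal.isPrime_bot⟩ (by simp)
  have restrict_ne_zero : ((Dual.eval A M).baseChange B).dualMap
      (Dual.baseChange B (Dual.eval A (Dual A M) g)) ≠ 0 := fun h0 =>
    hg.baseChange.apply_notMem (LinearMap.congr_fun h0 (1 ⊗ₜ e))
  exact ⟨hsurj.dualMap_injective,
    hsurj.dualMap_surjective h.genericGenerator_baseChange restrict_ne_zero⟩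

theorem doubleDual_baseChange_doubleDual [IsDomain B] [IsNoetherianRing B] [IsIntegrallyClosed B]
    (h : HasLocalGeneratorsInCodimOne A B M) :
    Nonempty (DoubleDual B (B ⊗[A] DoubleDual A M) ≃ₗ[B] DoubleDual B (B ⊗[A] M)) :=
  ⟨(LinearEquiv.ofBijective _ h.dualMap_baseChange_dual_eval_bijective).symm.dualMap⟩

end HasLocalGeneratorsInCodimOne

end BaseChange

end DivisorClass

open DivisorClass in
theorem ContractsToUFDLocus.hasLocalGeneratorsInCodimOne {A B : Type u} [CommRing A] [IsDomain A]
    [IsNoetherianRing A] [CommRing B] [Algebra A B] (h : ContractsToUFDLocus (algebraMap A B))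
    (M : Type u) [AddCommGroup M] [Module A M] [IsRankOneReflexive A M] :
    HasLocalGeneratorsInCodimOne A B M :=
  fun P hP => hasLocalGenerator_of_mem_UFDLocus (h P hP)

namespace DivisorClass.GenericGenerator

variable {A : Type u} [CommRing A] [IsDomain A] [IsNoetherianRing A]
  {M N : Type u} [AddCommGroup M] [Module A M] [Module.Finite A M]
  [AddCommGroup N] [Module A N] [Module.Finite A N]

/-- The divisor class of a finitely generated module of rank one: the class of its double dual. -/
def divisorClass (h : GenericGenerator A M) : DivisorClassGroup A :=
  haveI := isRankOneReflexive_dual h.dual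
  DivisorClassGroup.cl A (DoubleDual A M)

theorem divisorClass_eq_iff {hM : GenericGenerator A M} {hN : GenericGenerator A N} :
    hM.divisorClass = hN.divisorClass ↔ Nonempty (DoubleDual A M ≃ₗ[A] DoubleDual A N) :=
  haveI := isRankOneReflexive_dual hM.dual
  haveI := isRankOneReflexive_dual hN.dual
  DivisorClassGroup.cl_eq_cl

theorem divisorClass_congr {hM : GenericGenerator A M} {hN : GenericGenerator A N}
    (e : M ≃ₗ[A] N) : hM.divisorClass = hN.divisorClass :=
  divisorClass_eq_iff.2 (doubleDual_congr e)

theorem divisorClass_doubleDual_tensor (hM : GenericGenerator A M) (hN : GenericGenerator A N) :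
    (hM.dual.dual.tensor hN).divisorClass = (hM.tensor hN).divisorClass :=
  divisorClass_eq_iff.2 (doubleDual_tensor_doubleDual hM)

theorem divisorClass_mul_divisorClass (hM : GenericGenerator A M) (hN : GenericGenerator A N) :
    hM.divisorClass * hN.divisorClass = (hM.tensor hN).divisorClass :=
  calc hM.divisorClass * hN.divisorClass
      = (hM.dual.dual.tensor hN.dual.dual).divisorClass := rfl
    _ = (hM.tensor hN.dual.dual).divisorClass := divisorClass_doubleDual_tensor hM hN.dual.dual
    _ = (hN.dual.dual.tensor hM).divisorClass := divisorClass_congr (TensorProduct.comm A _ _)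
    _ = (hN.tensor hM).divisorClass := divisorClass_doubleDual_tensor hN hM
    _ = (hM.tensor hN).divisorClass := divisorClass_congr (TensorProduct.comm A N M)

end DivisorClass.GenericGenerator

namespace DivisorClassGroup

attribute [local instance] IsRankOneReflexive.finite

open DivisorClass DivisorClass.GenericGenerator

variable {A B : Type u} [CommRing A] [IsDomain A] [IsNoetherianRing A]
  [CommRing B] [IsDomain B] [IsNoetherianRing B] [Algebra A B]

/-- The map `[M] ↦ [(B ⊗ M)**]` of divisor classes underlying `baseChangeHom`. -/
def baseChangeMap (h : ContractsToUFDLocus (algebraMap A B)) :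
    DivisorClassGroup A → DivisorClassGroup B :=
  Quotient.lift
    (fun M => (h.hasLocalGeneratorsInCodimOne M.carrier).genericGenerator_baseChange.divisorClass)
    fun _ _ ⟨e⟩ => divisorClass_congr (e.baseChange A B _ _)

theorem baseChangeMap_cl (h : ContractsToUFDLocus (algebraMap A B)) (M : Type u)
    [AddCommGroup M] [Module A M] [IsRankOneReflexive A M] :
    baseChangeMap h (cl A M) =
      (h.hasLocalGeneratorsInCodimOne M).genericGenerator_baseChange.divisorClass :=
  rfl

variable [IsIntegrallyClosed B]

theorem baseChangeMap_divisorClass (h : ContractsToUFDLocus (algebraMap A B)) {M : Type u}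
    [AddCommGroup M] [Module A M] [Module.Finite A M] (hM : HasLocalGeneratorsInCodimOne A B M) :
    baseChangeMap h hM.genericGenerator.divisorClass =
      hM.genericGenerator_baseChange.divisorClass :=
  have := isRankOneReflexive_dual hM.genericGenerator.dual
  have h' := h.hasLocalGeneratorsInCodimOne (DoubleDual A M)
  divisorClass_eq_iff (hM := h'.genericGenerator_baseChange)
    (hN := hM.genericGenerator_baseChange) |>.2 hM.doubleDual_baseChange_doubleDual

theorem baseChangeMap_mul (h : ContractsToUFDLocus (algebraMap A B)) (x y : DivisorClassGroup A) :
    baseChangeMap h (x * y) = baseChangeMap h x * baseChangeMap h y := by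
  induction x using ind with | _ M
  induction y using ind with | _ N
  have hM := h.hasLocalGeneratorsInCodimOne M
  have hN := h.hasLocalGeneratorsInCodimOne N
  calc baseChangeMap h (cl A M * cl A N)
      = baseChangeMap h (hM.tensor hN).genericGenerator.divisorClass := rfl
    _ = (hM.tensor hN).genericGenerator_baseChange.divisorClass :=
      baseChangeMap_divisorClass h (hM.tensor hN)
    _ = (hM.genericGenerator_baseChange.tensor hN.genericGenerator_baseChange).divisorClass :=
      divisorClass_congr (AlgebraTensorModule.distribBaseChange A B M N)
    _ = baseChangeMap h (cl A M) * baseChangeMap h (cl A N) :=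
      (divisorClass_mul_divisorClass
        hM.genericGenerator_baseChange hN.genericGenerator_baseChange).symm

variable [IsIntegrallyClosed A]

/-- The homomorphism `Cl(A) → Cl(B)` induced by a normal `A`-algebra `B` satisfying `(†)`. -/
def baseChangeHom (h : ContractsToUFDLocus (algebraMap A B)) :
    DivisorClassGroup A →* DivisorClassGroup B :=
  MonoidHom.mk' (baseChangeMap h) (baseChangeMap_mul h)

theorem baseChangeHom_comp {C : Type u} [CommRing C] [IsDomain C] [IsNoetherianRing C]
    [IsIntegrallyClosed C] [Algebra B C] [Algebra A C] [IsScalarTower A B C]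
    (hAB : ContractsToUFDLocus (algebraMap A B)) (hBC : ContractsToUFDLocus (algebraMap B C))
    (hAC : ContractsToUFDLocus (algebraMap A C)) :
    baseChangeHom hAC = (baseChangeHom hBC).comp (baseChangeHom hAB) := by
  ext x
  induction x using ind with | _ M
  have hM : HasLocalGeneratorsInCodimOne A C M := hAC.hasLocalGeneratorsInCodimOne M
  have hBM : HasLocalGeneratorsInCodimOne B C (B ⊗[A] M) := hM.baseChange
  calc baseChangeMap hAC (cl A M)
      = hM.genericGenerator_baseChange.divisorClass := baseChangeMap_cl hAC M
    _ = hBM.genericGenerator_baseChange.divisorClass :=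
      divisorClass_congr (AlgebraTensorModule.cancelBaseChange A B C C M).symm
    _ = baseChangeMap hBC hBM.genericGenerator.divisorClass :=
      (baseChangeMap_divisorClass hBC hBM).symm
    _ = baseChangeMap hBC (baseChangeMap hAB (cl A M)) := by rw [baseChangeMap_cl]

theorem isInducedClassMap_baseChangeHom {A B : Type u} [CommRing A] [IsDomain A]
    [IsNoetherianRing A] [IsIntegrallyClosed A] [CommRing B] [IsDomain B] [IsNoetherianRing B]
    [IsIntegrallyClosed B] {φ : A →+* B} (h : ContractsToUFDLocus φ) :
    letI := φ.toAlgebra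
    IsInducedClassMap φ (baseChangeHom (A := A) (B := B) h) := by
  let _ := φ.toAlgebra
  intro M _ _ _
  have hM : HasLocalGeneratorsInCodimOne A B M := h.hasLocalGeneratorsInCodimOne M
  exact ⟨isRankOneReflexive_dual hM.genericGenerator_baseChange.dual, rfl⟩

end DivisorClassGroup

theorem mainTheorem4 {A B C : Type u}
    [CommRing A] [IsDomain A] [IsNoetherianRing A] [IsIntegrallyClosed A]
    [CommRing B] [IsDomain B] [IsNoetherianRing B] [IsIntegrallyClosed B]
    [CommRing C] [IsDomain C] [IsNoetherianRing C] [IsIntegrallyClosed C]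
    (φ : A →+* B) (ψ : B →+* C)
    (hφ : ContractsToUFDLocus φ) (hψ : ContractsToUFDLocus ψ)
    (hψφ : ContractsToUFDLocus (ψ.comp φ)) :
    ∃ (Clφ : DivisorClassGroup A →* DivisorClassGroup B)
      (Clψ : DivisorClassGroup B →* DivisorClassGroup C)
      (Clψφ : DivisorClassGroup A →* DivisorClassGroup C),
      IsInducedClassMap φ Clφ ∧ IsInducedClassMap ψ Clψ ∧ IsInducedClassMap (ψ.comp φ) Clψφ ∧
        Clψφ = Clψ.comp Clφ := by
  let _ : Algebra A B := φ.toAlgebra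
  let _ : Algebra B C := ψ.toAlgebra
  let _ : Algebra A C := (ψ.comp φ).toAlgebra
  have : IsScalarTower A B C := .of_algebraMap_eq fun _ => rfl
  exact ⟨_, _, _,
    DivisorClassGroup.isInducedClassMap_baseChangeHom hφ,
    DivisorClassGroup.isInducedClassMap_baseChangeHom hψ,
    DivisorClassGroup.isInducedClassMap_baseChangeHom hψφ,
    DivisorClassGroup.baseChangeHom_comp hφ hψ hψφ⟩
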